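/- Proposition 3.3 (prop:quotient_metric). Let $\mathcal M$ be a finite-dimensional smooth manifold and let $\mathcal G$ be a Lie group acting on $\mathcal M$ by a smooth, free and proper action $\theta$, with $\theta_{\mathcal A}=\theta(\cdot,\mathcal A)$. Let $\mathcal M/\mathcal G$ be the quotient manifold, i.e. the orbit space with the quotient topology and the (unique) smooth structure for which the quotient map $\pi:\mathcal M\to\mathcal M/\mathcal G$, $x\mapsto[x]$, is a smooth submersion, and let $V_x\mathcal M=\ker \mathrm d\pi(x)$ be the vertical space at $x$. A horizontal space is a family of linear subspaces $H_x\mathcal M\subseteq T_x\mathcal M$ $(x\in\mathcal M)$ that depends smoothly on $x$ (locally it has a basis of smooth vector fields), satisfies $T_x\mathcal M=H_x\mathcal M\oplus V_x\mathcal M$ for all $x$, and is invariant: $\mathrm d\theta_{\mathcal A}(x)[H_x\mathcal M]=H_{\theta(x,\mathcal A)}\mathcal M$ for all $x\in\mathcal M$, $\mathcal A\in\mathcal G$; it need not be orthogonal to the vertical space. For $\xi\in T_{[x]}(\mathcal M/\mathcal G)$ the horizontal lift $\mathrm{lift}_x(\xi)$ is the unique vector of $H_x\mathcal M$ with $\mathrm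 d\pi(x)[\mathrm{lift}_x(\xi)]=\xi$. Let $g$ be a smooth Riemannian metric on $\mathcal M$ for which $\theta$ is isometric, i.e. $g_{\theta(x,\mathcal A)}(\mathrm d\theta_{\mathcal A}(x)[\xi],\mathrm d\theta_{\mathcal A}(x)[\eta])=g_x(\xi,\eta)$ for all $x\in\mathcal M$, $\mathcal A\in\mathcal G$ and $\xi,\eta\in T_x\mathcal M$, and let $x\mapsto H_x\mathcal M$ be any horizontal space. Then there is exactly one smooth Riemannian metric $\hat g$ on $\mathcal M/\mathcal G$ such that $$\hat g_{[x]}(\xi,\eta)=g_x(\mathrm{lift}_x(\xi),\mathrm{lift}_x(\eta))\qquad\text{for all }x\in\mathcal M\text{ and all }\xi,\eta\in T_{[x]}(\mathcal M/\mathcal G).$$ -/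

import Mathlib

open scoped Manifold ContDiff Bundle

noncomputable section

namespace QuotientMetric

/-- The quotient map `π : M → M/G`, `x ↦ [x]`, onto the orbit space of a group action. -/
def proj (G : Type*) {M : Type*} [Group G] [MulAction G M] (x : M) :
    MulAction.orbitRel.Quotient G M :=
  Quotient.mk _ x

section Distribution

variable {E : Type*} [NormedAddCommGroup E] [NormedSpace ℝ E]
  {M : Type*} [TopologicalSpace M] [ChartedSpace E M] [IsManifold 𝓘(ℝ, E) ∞ M]

/-- A family of subspaces `D x ⊆ T_x M` depends smoothly on `x` if around every point there are
finitely many smooth vector fields which form a basis of `D x` at every point `x` near it. -/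
def IsSmoothDistribution (D : ∀ x : M, Submodule ℝ (TangentSpace 𝓘(ℝ, E) x)) : Prop :=
  ∀ x₀ : M, ∃ U : Set M, IsOpen U ∧ x₀ ∈ U ∧
    ∃ (k : ℕ) (X : Fin k → ∀ x : M, TangentSpace 𝓘(ℝ, E) x),
      (∀ i, ContMDiffOn 𝓘(ℝ, E) 𝓘(ℝ, E).tangent ∞
        (fun x ↦ (⟨x, X i x⟩ : TangentBundle 𝓘(ℝ, E) M)) U) ∧
      ∀ x ∈ U, LinearIndependent ℝ (fun i ↦ X i x) ∧
        Submodule.span ℝ (Set.range fun i ↦ X i x) = D x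

end Distribution

section Quotient

variable (G : Type*) [Group G]
  {E : Type*} [NormedAddCommGroup E] [NormedSpace ℝ E]
  {M : Type*} [TopologicalSpace M] [ChartedSpace E M] [MulAction G M]
  (E' : Type*) [NormedAddCommGroup E'] [NormedSpace ℝ E']
  [ChartedSpace E' (MulAction.orbitRel.Quotient G M)]

/-- The differential `dπ(x) : T_x M → T_[x] (M/G)` of the quotient map. -/
def dproj (x : M) :
    TangentSpace 𝓘(ℝ, E) x →L[ℝ] TangentSpace 𝓘(ℝ, E') (proj G x) :=
  mfderiv 𝓘(ℝ, E) 𝓘(ℝ, E') (proj G : M → MulAction.orbitRel.Quotient G M) x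

/-- The vertical space `V_x M = ker dπ(x)`. -/
def vertical (x : M) : Submodule ℝ (TangentSpace 𝓘(ℝ, E) x) :=
  (dproj G E' x).toLinearMap.ker

variable (E M) in
/-- The given smooth structure on the orbit space `M/G` (which carries the quotient topology) is
that of the quotient manifold: the quotient map `π : M → M/G` is a smooth submersion.
At most one smooth structure on `M/G` has this property. -/
structure IsQuotientManifold : Prop where
  contMDiff : ContMDiff 𝓘(ℝ, E) 𝓘(ℝ, E') ∞
    (proj G : M → MulAction.orbitRel.Quotient G M)
  surjective : ∀ x : M, Function.Surjective (dproj (E := E) G E' x)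

variable (E M) in
/-- A horizontal space: a family of subspaces `H_x M ⊆ T_x M` complementary to the vertical spaces,
depending smoothly on `x`, and invariant under the group action:
`dθ_a(x)[H_x M] = H_{a • x} M`. It is not required to be orthogonal to the vertical space. -/
structure HorizontalSpace [IsManifold 𝓘(ℝ, E) ∞ M] where
  space : ∀ x : M, Submodule ℝ (TangentSpace 𝓘(ℝ, E) x)
  isCompl : ∀ x : M, IsCompl (space x) (vertical G E' x)
  smooth : IsSmoothDistribution space
  invariant : ∀ (a : G) (x : M),
    (space x).map (mfderiv 𝓘(ℝ, E) 𝓘(ℝ, E) (fun y : M ↦ a • y) x).toLinearMap = space (a • x)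

variable {G E'} [IsManifold 𝓘(ℝ, E) ∞ M]

/-- The restriction of `dπ(x)` to `H_x M` is a bijection onto `T_[x] (M/G)`. -/
theorem HorizontalSpace.bijective (hQ : IsQuotientManifold G E M E')
    (H : HorizontalSpace G E M E') (x : M) :
    Function.Bijective ((dproj G E' x).toLinearMap.domRestrict (H.space x)) := by
  constructor
  · rw [← LinearMap.ker_eq_bot, LinearMap.ker_eq_bot']
    rintro ⟨v, hv⟩ h
    have hv' : v ∈ vertical G E' x := h
    have := Submodule.disjoint_def.1 (H.isCompl x).disjoint v hv hv'
    exact Subtype.ext this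
  · intro ξ
    obtain ⟨w, rfl⟩ := hQ.surjective x ξ
    obtain ⟨u, hu, v, hv, rfl⟩ := Submodule.mem_sup.1
      (show w ∈ H.space x ⊔ vertical G E' x by
        rw [(H.isCompl x).sup_eq_top]; exact Submodule.mem_top)
    refine ⟨⟨u, hu⟩, ?_⟩
    have hv' : dproj G E' x v = 0 := hv
    change dproj G E' x u = dproj G E' x (u + v)
    rw [map_add, hv', add_zero]

/-- The horizontal lift `lift_x = (dπ(x)|_{H_x M})⁻¹ : T_[x] (M/G) → H_x M ⊆ T_x M`. -/
def HorizontalSpace.lift (hQ : IsQuotientManifold G E M E')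
    (H : HorizontalSpace G E M E') (x : M) :
    TangentSpace 𝓘(ℝ, E') (proj G x) →ₗ[ℝ] TangentSpace 𝓘(ℝ, E) x :=
  (H.space x).subtype ∘ₗ (LinearEquiv.ofBijective _ (H.bijective hQ x)).symm.toLinearMap

variable (G) in
/-- The action is isometric for the Riemannian metric `g`: every differential
`dθ_a(x) : T_x M → T_{a • x} M` preserves the inner products. -/
def IsIsometricAction
    (g : Bundle.ContMDiffRiemannianMetric 𝓘(ℝ, E) ∞ E
      (fun x : M ↦ TangentSpace 𝓘(ℝ, E) x)) : Prop :=
  ∀ (a : G) (x : M) (ξ η : TangentSpace 𝓘(ℝ, E) x),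
    g.inner (a • x) (mfderiv 𝓘(ℝ, E) 𝓘(ℝ, E) (fun y : M ↦ a • y) x ξ)
      (mfderiv 𝓘(ℝ, E) 𝓘(ℝ, E) (fun y : M ↦ a • y) x η) = g.inner x ξ η

end Quotient

end QuotientMetric

end

/-!
The metric on `M/G` is forced: since `π` is surjective, the required identity prescribes
`ĝ_[x](ξ, η) = g_x(lift_x ξ, lift_x η)` at every point, which gives uniqueness.

For existence, this formula must not depend on the representative `x`. Differentiating `π ∘ θ_a = π`
and using the invariance of the horizontal space gives `lift_{a • x} = dθ_a(x) ∘ lift_x`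
(`HorizontalSpace.lift_smul`), and `dθ_a` preserves `g`
(`HorizontalSpace.pullbackForm_eq_of_proj_eq`). Positivity holds because lifts are injective, and
the unit ball of `ĝ` at `[x]` is bounded because it lies in the image under `dπ(x)` of the unit ball
of `g_x`.

It remains to see that `ĝ` is smooth. As `π` is a submersion, it has smooth local sections, so it is
enough to check this after composition with `π` (`ContMDiffAt.of_comp_submersion`). A local smooth
frame `X` of the horizontal space yields a smooth frame `dπ(X i)` along `π`, whose lifts are the
`X i`; hence the coefficients of `ĝ` in this frame are the smooth functions `g(X i, X j)`. A family
of bilinear forms with smooth coefficients in a smooth frame is smooth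
(`contMDiffAt_bilin_of_frame`), as matrix inversion is smooth.
-/

/-! ### Local sections of submersions -/

section Submersion

open Filter Topology

variable {E : Type*} [NormedAddCommGroup E] [NormedSpace ℝ E]
  {M : Type*} [TopologicalSpace M] [ChartedSpace E M] [IsManifold 𝓘(ℝ, E) ∞ M]
  {E' : Type*} [NormedAddCommGroup E'] [NormedSpace ℝ E'] [FiniteDimensional ℝ E']
  {N : Type*} [TopologicalSpace N] [ChartedSpace E' N]
  {p : M → N} {x₀ : M}

/-- A map that is smooth at `x₀` with surjective differential there has a right inverse `σ` near
`p x₀`, smooth at `p x₀` and passing through `x₀`. In charts, restricting `p` to an affine subspace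
complementary to the kernel of its differential gives a local diffeomorphism. -/
theorem ContMDiffAt.exists_local_section
    (hp : ContMDiffAt 𝓘(ℝ, E) 𝓘(ℝ, E') ∞ p x₀)
    (hsurj : Function.Surjective (mfderiv 𝓘(ℝ, E) 𝓘(ℝ, E') p x₀)) :
    ∃ σ : N → M, ContMDiffAt 𝓘(ℝ, E') 𝓘(ℝ, E) ∞ σ (p x₀) ∧ σ (p x₀) = x₀ ∧
      ∀ᶠ q in 𝓝 (p x₀), p (σ q) = q := by
  set φ := extChartAt 𝓘(ℝ, E) x₀ with hφ
  set ψ := extChartAt 𝓘(ℝ, E') (p x₀) with hψ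
  set f : E → E' := writtenInExtChartAt 𝓘(ℝ, E) 𝓘(ℝ, E') x₀ p with hf
  have hfs : ContDiffAt ℝ ∞ f (φ x₀) := by
    have := (contMDiffAt_iff.1 hp).2
    rw [ModelWithCorners.range_eq_univ, contDiffWithinAt_univ] at this
    exact this
  have hd : mfderiv 𝓘(ℝ, E) 𝓘(ℝ, E') p x₀ = fderiv ℝ f (φ x₀) := by
    rw [(hp.mdifferentiableAt (by simp)).mfderiv, ModelWithCorners.range_eq_univ,
      fderivWithin_univ]
  have hsurj' : Function.Surjective (fderiv ℝ f (φ x₀)) := by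
    rw [← hd]; exact hsurj
  -- With a linear right inverse `R` of the differential, `w ↦ f (φ x₀ + R w)` has differential `id`
  -- at `0`, so the inverse function theorem applies to it.
  obtain ⟨R, hR⟩ := (fderiv ℝ f (φ x₀)).exists_rightInverse_of_surjective
    (LinearMap.range_eq_top.2 hsurj')
  set A : E' → E := fun w ↦ φ x₀ + R w with hA
  have hAs : ContDiff ℝ ∞ A := contDiff_const.add R.contDiff
  have hA0 : A 0 = φ x₀ := by simp [hA]
  have hhs : ContDiffAt ℝ ∞ (f ∘ A) 0 := by
    refine ContDiffAt.comp 0 ?_ hAs.contDiffAt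
    rwa [hA0]
  have hhd : HasFDerivAt (f ∘ A)
      ((ContinuousLinearEquiv.refl ℝ E' : E' ≃L[ℝ] E') : E' →L[ℝ] E') 0 := by
    have h1 : HasFDerivAt f (fderiv ℝ f (φ x₀)) (A 0) := by
      rw [hA0]; exact (hfs.differentiableAt (by simp)).hasFDerivAt
    have h2 : HasFDerivAt A R 0 := R.hasFDerivAt.const_add _
    have := h1.comp 0 h2
    rw [hR] at this
    exact this
  have : CompleteSpace E' := FiniteDimensional.complete ℝ E'
  set k := hhs.localInverse hhd (by simp) with hk
  have hfφ : f (φ x₀) = ψ (p x₀) := by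
    simp [hf, hφ, hψ, writtenInExtChartAt]
  have hh0 : (f ∘ A) 0 = ψ (p x₀) := by simp only [Function.comp, hA0, hfφ]
  have hk0 : k (ψ (p x₀)) = 0 := by
    rw [← hh0]; exact hhs.localInverse_apply_image hhd (by simp)
  have hks : ContDiffAt ℝ ∞ k (ψ (p x₀)) := by
    rw [← hh0]; exact hhs.to_localInverse hhd (by simp)
  have hkinv : ∀ᶠ z in 𝓝 (ψ (p x₀)), f (A (k z)) = z := by
    rw [← hh0]
    exact (hhs.hasStrictFDerivAt' hhd (by simp)).eventually_right_inverse
  have hψs : ContMDiffAt 𝓘(ℝ, E') 𝓘(ℝ, E') ∞ ψ (p x₀) := contMDiffAt_extChartAt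
  have hAk : A (k (ψ (p x₀))) = φ x₀ := by rw [hk0, hA0]
  have hinner : ContMDiffAt 𝓘(ℝ, E') 𝓘(ℝ, E) ∞ (fun q ↦ A (k (ψ q))) (p x₀) :=
    ((hAs.contDiffAt.comp _ hks).contMDiffAt).comp (p x₀) hψs
  have hσ : ContMDiffAt 𝓘(ℝ, E') 𝓘(ℝ, E) ∞ (fun q ↦ φ.symm (A (k (ψ q)))) (p x₀) := by
    refine ContMDiffAt.comp (g := φ.symm) (p x₀) ?_ hinner
    rw [hAk]
    exact (contMDiffOn_extChartAt_symm x₀).contMDiffAt (extChartAt_target_mem_nhds x₀)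
  have hσ0 : φ.symm (A (k (ψ (p x₀)))) = x₀ := by rw [hAk]; exact extChartAt_to_inv x₀
  refine ⟨fun q ↦ φ.symm (A (k (ψ q))), hσ, hσ0, ?_⟩
  have hpσ : Tendsto (fun q ↦ p (φ.symm (A (k (ψ q))))) (𝓝 (p x₀)) (𝓝 (p x₀)) := by
    have h1 := hσ.continuousAt
    have h2 : ContinuousAt p (φ.symm (A (k (ψ (p x₀))))) := by
      rw [hσ0]; exact hp.continuousAt
    have := ContinuousAt.comp (g := p) (f := fun q ↦ φ.symm (A (k (ψ q)))) h2 h1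
    simpa only [ContinuousAt, Function.comp_def, hσ0] using this
  filter_upwards [hpσ (extChartAt_source_mem_nhds (I := 𝓘(ℝ, E')) (p x₀)),
    extChartAt_source_mem_nhds (I := 𝓘(ℝ, E')) (p x₀),
    hψs.continuousAt.eventually hkinv] with q h1 h2 h3
  exact ψ.injOn h1 h2 h3

/-- Smoothness descends along submersions: `f` is `f ∘ p` composed with a local section of `p`. -/
theorem ContMDiffAt.of_comp_submersion
    {V : Type*} [NormedAddCommGroup V] [NormedSpace ℝ V] {H : Type*} [TopologicalSpace H]
    {I : ModelWithCorners ℝ V H} {P : Type*} [TopologicalSpace P] [ChartedSpace H P]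
    {f : N → P}
    (hp : ContMDiffAt 𝓘(ℝ, E) 𝓘(ℝ, E') ∞ p x₀)
    (hsurj : Function.Surjective (mfderiv 𝓘(ℝ, E) 𝓘(ℝ, E') p x₀))
    (hf : ContMDiffAt 𝓘(ℝ, E) I ∞ (f ∘ p) x₀) :
    ContMDiffAt 𝓘(ℝ, E') I ∞ f (p x₀) := by
  obtain ⟨σ, hσ, hσ0, hpσ⟩ := hp.exists_local_section hsurj
  refine (hf.comp_of_eq hσ hσ0).congr_of_eventuallyEq ?_
  filter_upwards [hpσ] with q hq
  simp [hq]

end Submersion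

/-! ### Bilinear forms on the base of a submersion -/

section DescendedForm

open Filter Topology Bundle

/-- The expansion `b = ∑ b (y i) (y j) • θ i ⊗ θ j` of a bilinear form in a basis `y`. The basis is
encoded by the isomorphism `e : c ↦ ∑ c i • y i`, and the dual basis `θ` by the rows of `e⁻¹`. -/
theorem bilin_eq_sum_of_basis {V : Type*} [NormedAddCommGroup V] [NormedSpace ℝ V] {k : ℕ}
    (b : V →L[ℝ] V →L[ℝ] ℝ) (e : (Fin k → ℝ) ≃L[ℝ] V) (y : Fin k → V)
    (hy : ∀ c, e c = ∑ i, c i • y i) :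
    b = ∑ i, ∑ j, b (y i) (y j) •
      ContinuousLinearMap.smulRightL ℝ V (V →L[ℝ] ℝ)
        ((ContinuousLinearMap.proj i).comp (e.symm : V →L[ℝ] (Fin k → ℝ)))
        ((ContinuousLinearMap.proj j).comp (e.symm : V →L[ℝ] (Fin k → ℝ))) := by
  ext v w
  obtain ⟨c, rfl⟩ := e.surjective v
  obtain ⟨d, rfl⟩ := e.surjective w
  simp only [sum_apply, smul_apply,
    ContinuousLinearMap.smulRightL_apply_apply, ContinuousLinearMap.comp_apply,
    ContinuousLinearMap.smulRight_apply, ContinuousLinearMap.proj_apply,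
    ContinuousLinearEquiv.coe_coe, ContinuousLinearEquiv.symm_apply_apply]
  rw [hy c, hy d]
  simp only [map_sum, map_smul, sum_apply, smul_apply,
    smul_eq_mul, Finset.mul_sum]
  rw [Finset.sum_comm]
  refine Finset.sum_congr rfl fun i _ ↦ Finset.sum_congr rfl fun j _ ↦ ?_
  ring

variable {E : Type*} [NormedAddCommGroup E] [NormedSpace ℝ E]
  {M : Type*} [TopologicalSpace M] [ChartedSpace E M]
  {E' : Type*} [NormedAddCommGroup E'] [NormedSpace ℝ E']
  {N : Type*} [TopologicalSpace N] [ChartedSpace E' N] [IsManifold 𝓘(ℝ, E') ∞ N]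
  {p : M → N}

theorem ContMDiffAt.clm_smulRightL {V W : Type*} [NormedAddCommGroup V] [NormedSpace ℝ V]
    [NormedAddCommGroup W] [NormedSpace ℝ W] {θ : M → V →L[ℝ] ℝ} {f : M → W} {x₀ : M}
    (hθ : ContMDiffAt 𝓘(ℝ, E) 𝓘(ℝ, V →L[ℝ] ℝ) ∞ θ x₀)
    (hf : ContMDiffAt 𝓘(ℝ, E) 𝓘(ℝ, W) ∞ f x₀) :
    ContMDiffAt 𝓘(ℝ, E) 𝓘(ℝ, V →L[ℝ] W) ∞
      (fun x ↦ ContinuousLinearMap.smulRightL ℝ V W (θ x) (f x)) x₀ :=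
  (contMDiffAt_const.clm_apply hθ).clm_apply hf

/-- A family of bilinear forms on the tangent spaces of `N`, pulled back along `p : M → N`, is
smooth at `x₀` if its coefficients in a smooth frame along `p` are. -/
theorem contMDiffAt_bilin_of_frame {x₀ : M} {k : ℕ}
    (hp : ContMDiffAt 𝓘(ℝ, E) 𝓘(ℝ, E') ∞ p x₀)
    (h : ∀ q : N, TangentSpace 𝓘(ℝ, E') q →L[ℝ] TangentSpace 𝓘(ℝ, E') q →L[ℝ] ℝ)
    (Y : Fin k → ∀ x : M, TangentSpace 𝓘(ℝ, E') (p x))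
    (hY : ∀ i, ContMDiffAt 𝓘(ℝ, E) 𝓘(ℝ, E').tangent ∞
        (fun x ↦ (⟨p x, Y i x⟩ : TangentBundle 𝓘(ℝ, E') N)) x₀)
    (hbasis : ∀ᶠ x in 𝓝 x₀, Function.Bijective (fun c : Fin k → ℝ ↦ ∑ i, c i • Y i x))
    (hh : ∀ i j, ContMDiffAt 𝓘(ℝ, E) 𝓘(ℝ, ℝ) ∞ (fun x ↦ h (p x) (Y i x) (Y j x)) x₀) :
    ContMDiffAt 𝓘(ℝ, E) (𝓘(ℝ, E').prod 𝓘(ℝ, E' →L[ℝ] E' →L[ℝ] ℝ)) ∞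
      (fun x ↦ TotalSpace.mk' (E' →L[ℝ] E' →L[ℝ] ℝ)
        (E := fun q : N ↦ TangentSpace 𝓘(ℝ, E') q →L[ℝ] TangentSpace 𝓘(ℝ, E') q →L[ℝ] ℝ)
        (p x) (h (p x))) x₀ := by
  set τ := trivializationAt E' (TangentSpace 𝓘(ℝ, E') : N → Type _) (p x₀) with hτ
  have hbase : ∀ᶠ x in 𝓝 x₀, p x ∈ τ.baseSet :=
    hp.continuousAt (τ.open_baseSet.mem_nhds (mem_baseSet_trivializationAt _ _ _))
  -- `B x` maps the coefficients of a vector in the frame to its coordinates in the trivialization;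
  -- the rows `θ i` of its inverse form the dual coframe.
  let y : Fin k → M → E' := fun i x ↦ (τ ⟨p x, Y i x⟩).2
  have hy : ∀ i, ContMDiffAt 𝓘(ℝ, E) 𝓘(ℝ, E') ∞ (y i) x₀ := fun i ↦
    (contMDiffAt_totalSpace.1 (hY i)).2
  let B : M → (Fin k → ℝ) →L[ℝ] E' := fun x ↦
    ∑ i, ContinuousLinearMap.smulRightL ℝ (Fin k → ℝ) E' (ContinuousLinearMap.proj i) (y i x)
  have hB : ∀ x c, B x c = ∑ i, c i • y i x := fun x c ↦ by
    simp [B]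
  have hBs : ContMDiffAt 𝓘(ℝ, E) 𝓘(ℝ, (Fin k → ℝ) →L[ℝ] E') ∞ B x₀ :=
    contMDiffAt_finsetSum fun i _ ↦ contMDiffAt_const.clm_smulRightL (hy i)
  have hBe : ∀ᶠ x in 𝓝 x₀, ∃ e : (Fin k → ℝ) ≃L[ℝ] E', (e : (Fin k → ℝ) →L[ℝ] E') = B x := by
    filter_upwards [hbase, hbasis] with x hx hb
    have hBτ : ∀ c, B x c = τ.continuousLinearEquivAt ℝ (p x) hx (∑ i, c i • Y i x) := fun c ↦ by
      rw [hB, map_sum]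
      simp only [map_smul]
      rfl
    have hbij : Function.Bijective (B x) := by
      have : (B x : (Fin k → ℝ) → E') = τ.continuousLinearEquivAt ℝ (p x) hx ∘
          (fun c : Fin k → ℝ ↦ ∑ i, c i • Y i x) := funext hBτ
      rw [this]
      exact (τ.continuousLinearEquivAt ℝ (p x) hx).bijective.comp hb
    exact ⟨(LinearEquiv.ofBijective (B x).toLinearMap hbij).toContinuousLinearEquiv, by ext; rfl⟩
  have hinv : ContMDiffAt 𝓘(ℝ, E) 𝓘(ℝ, E' →L[ℝ] (Fin k → ℝ)) ∞
      (fun x ↦ (B x).inverse) x₀ := by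
    have : (B x₀).IsInvertible := hBe.self_of_nhds
    exact (this.contDiffAt_map_inverse.contMDiffAt).comp x₀ hBs
  let θ : Fin k → M → E' →L[ℝ] ℝ := fun i x ↦ (ContinuousLinearMap.proj i).comp (B x).inverse
  have hθ : ∀ i, ContMDiffAt 𝓘(ℝ, E) 𝓘(ℝ, E' →L[ℝ] ℝ) ∞ (θ i) x₀ := fun i ↦
    contMDiffAt_const.clm_comp hinv
  rw [contMDiffAt_hom_bundle]
  refine ⟨hp, ?_⟩
  have hθθ : ∀ i j, ContMDiffAt 𝓘(ℝ, E) 𝓘(ℝ, E' →L[ℝ] E' →L[ℝ] ℝ) ∞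
      (fun x ↦ ContinuousLinearMap.smulRightL ℝ E' (E' →L[ℝ] ℝ) (θ i x) (θ j x)) x₀ := fun i j ↦
    (hθ i).clm_smulRightL (hθ j)
  have hsum : ContMDiffAt 𝓘(ℝ, E) 𝓘(ℝ, E' →L[ℝ] E' →L[ℝ] ℝ) ∞
      (fun x ↦ ∑ i, ∑ j, h (p x) (Y i x) (Y j x) •
        ContinuousLinearMap.smulRightL ℝ E' (E' →L[ℝ] ℝ) (θ i x) (θ j x)) x₀ :=
    contMDiffAt_finsetSum fun i _ ↦ contMDiffAt_finsetSum fun j _ ↦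
      ContMDiffAt.smul (hh i j) (hθθ i j)
  refine hsum.congr_of_eventuallyEq ?_
  filter_upwards [hbase, hBe] with x hx ⟨e, he⟩
  rw [bilin_eq_sum_of_basis (ContinuousLinearMap.inCoordinates E' (TangentSpace 𝓘(ℝ, E'))
    (E' →L[ℝ] ℝ) (fun q : N ↦ TangentSpace 𝓘(ℝ, E') q →L[ℝ] ℝ) (p x₀) (p x) (p x₀) (p x)
    (h (p x))) e (fun i ↦ y i x) fun c ↦ by rw [← hB, ← he]; rfl]
  refine Finset.sum_congr rfl fun i _ ↦ Finset.sum_congr rfl fun j _ ↦ ?_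
  have hsymm : ∀ i, τ.symm (p x) (y i x) = Y i x := fun i ↦ τ.symm_apply_apply_mk hx (Y i x)
  congr 1
  · rw [inCoordinates_apply_eq₂ (E₃ := fun _ : N ↦ ℝ) hx hx (Set.mem_univ _)]
    simp only [← hτ, hsymm]
    simp
  · simp only [θ, ← he, ContinuousLinearMap.inverse_equiv]

/-- Let `p` be a surjective submersion and `D` a smooth distribution that `dp` maps isomorphically
onto the tangent spaces of the base. A family of bilinear forms `h` on the base is smooth if it
corresponds under `dp` to the restriction to `D` of a smooth family `g`. A smooth frame `X` of `D`
gives the smooth frame `dp(X i)` along `p`, in which the coefficients of `h` are `g (X i) (X j)`. -/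
theorem contMDiff_of_submersion_of_distribution [IsManifold 𝓘(ℝ, E) ∞ M] [FiniteDimensional ℝ E']
    (hp : ContMDiff 𝓘(ℝ, E) 𝓘(ℝ, E') ∞ p)
    (hsurj : ∀ x, Function.Surjective (mfderiv 𝓘(ℝ, E) 𝓘(ℝ, E') p x))
    (hp_surj : Function.Surjective p)
    {D : ∀ x : M, Submodule ℝ (TangentSpace 𝓘(ℝ, E) x)}
    (hD : QuotientMetric.IsSmoothDistribution D)
    (hbij : ∀ x, Function.Bijective
      ((mfderiv 𝓘(ℝ, E) 𝓘(ℝ, E') p x).toLinearMap.domRestrict (D x)))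
    {g : ∀ x : M, TangentSpace 𝓘(ℝ, E) x →L[ℝ] TangentSpace 𝓘(ℝ, E) x →L[ℝ] ℝ}
    (hg : ContMDiff 𝓘(ℝ, E) (𝓘(ℝ, E).prod 𝓘(ℝ, E →L[ℝ] E →L[ℝ] ℝ)) ∞
      (fun x ↦ TotalSpace.mk' (E →L[ℝ] E →L[ℝ] ℝ)
        (E := fun x : M ↦ TangentSpace 𝓘(ℝ, E) x →L[ℝ] TangentSpace 𝓘(ℝ, E) x →L[ℝ] ℝ) x (g x)))
    {h : ∀ q : N, TangentSpace 𝓘(ℝ, E') q →L[ℝ] TangentSpace 𝓘(ℝ, E') q →L[ℝ] ℝ}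
    (hgh : ∀ x, ∀ u ∈ D x, ∀ v ∈ D x, h (p x) (mfderiv 𝓘(ℝ, E) 𝓘(ℝ, E') p x u)
      (mfderiv 𝓘(ℝ, E) 𝓘(ℝ, E') p x v) = g x u v) :
    ContMDiff 𝓘(ℝ, E') (𝓘(ℝ, E').prod 𝓘(ℝ, E' →L[ℝ] E' →L[ℝ] ℝ)) ∞
      (fun q ↦ TotalSpace.mk' (E' →L[ℝ] E' →L[ℝ] ℝ)
        (E := fun q : N ↦ TangentSpace 𝓘(ℝ, E') q →L[ℝ] TangentSpace 𝓘(ℝ, E') q →L[ℝ] ℝ)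
        q (h q)) := by
  intro q
  obtain ⟨x₀, rfl⟩ := hp_surj q
  refine (hp x₀).of_comp_submersion (hsurj x₀) ?_
  obtain ⟨U, hU, hxU, k, X, hX, hXD⟩ := hD x₀
  have hXU : ∀ x ∈ U, ∀ i, X i x ∈ D x := fun x hx i ↦ by
    rw [← (hXD x hx).2]; exact Submodule.subset_span ⟨i, rfl⟩
  have hXs : ∀ i, ContMDiffAt 𝓘(ℝ, E) 𝓘(ℝ, E).tangent ∞
      (fun x ↦ (⟨x, X i x⟩ : TangentBundle 𝓘(ℝ, E) M)) x₀ := fun i ↦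
    (hX i).contMDiffAt (hU.mem_nhds hxU)
  refine contMDiffAt_bilin_of_frame (hp x₀) h
    (fun i x ↦ mfderiv 𝓘(ℝ, E) 𝓘(ℝ, E') p x (X i x)) (fun i ↦ ?_) ?_ (fun i j ↦ ?_)
  · exact ((hp.contMDiff_tangentMap (m := ∞) (by simp)).contMDiffAt).comp x₀ (hXs i)
  · filter_upwards [hU.mem_nhds hxU] with x hx
    obtain ⟨hli, hspan⟩ := hXD x hx
    have hval : ∀ c : Fin k → ℝ, ∑ i, c i • mfderiv 𝓘(ℝ, E) 𝓘(ℝ, E') p x (X i x) =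
        mfderiv 𝓘(ℝ, E) 𝓘(ℝ, E') p x (∑ i, c i • X i x) := fun c ↦ by
      rw [map_sum]; simp only [map_smul]
    have hmem : ∀ c : Fin k → ℝ, ∑ i, c i • X i x ∈ D x := fun c ↦
      Submodule.sum_mem _ fun i _ ↦ Submodule.smul_mem _ _ (hXU x hx i)
    constructor
    · intro c d hcd
      simp only [hval] at hcd
      have := congrArg Subtype.val ((hbij x).1 (a₁ := ⟨_, hmem c⟩) (a₂ := ⟨_, hmem d⟩) hcd)
      exact hli.fintypeLinearCombination_injective
        (by simpa [Fintype.linearCombination_apply] using this)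
    · intro ξ
      obtain ⟨⟨u, hu⟩, rfl⟩ := (hbij x).2 ξ
      rw [← hspan, Submodule.mem_span_range_iff_exists_fun] at hu
      obtain ⟨c, rfl⟩ := hu
      exact ⟨c, hval c⟩
  · have hg' : ContMDiffAt 𝓘(ℝ, E) (𝓘(ℝ, E).prod 𝓘(ℝ, ℝ)) ∞
        (fun x ↦ TotalSpace.mk' ℝ (E := Bundle.Trivial M ℝ) x (g x (X i x) (X j x))) x₀ :=
      ContMDiffAt.clm_bundle_apply₂ (F₁ := E) (F₂ := E) (hg x₀) (hXs i) (hXs j)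
    refine (contMDiffAt_totalSpace.1 hg').2.congr_of_eventuallyEq ?_
    filter_upwards [hU.mem_nhds hxU] with x hx
    exact hgh x _ (hXU x hx i) _ (hXU x hx j)

end DescendedForm

/-! ### Horizontal lifts and the metric on the orbit space -/

namespace QuotientMetric

open Bundle

section Lift

variable {G : Type*} [Group G]
  {E : Type*} [NormedAddCommGroup E] [NormedSpace ℝ E]
  {M : Type*} [MulAction G M]
  {E' : Type*} [NormedAddCommGroup E'] [NormedSpace ℝ E']

theorem proj_surjective : Function.Surjective (proj G : M → MulAction.orbitRel.Quotient G M) :=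
  Quotient.mk_surjective

theorem proj_smul (a : G) (x : M) : proj G (a • x) = proj G x :=
  Quotient.sound (MulAction.mem_orbit x a)

variable [TopologicalSpace M] [ChartedSpace E M]
  [ChartedSpace E' (MulAction.orbitRel.Quotient G M)]

/-- The chain rule for `π ∘ θ_a = π`. The two sides lie in the tangent spaces at `[a • x]` and
`[x]`; these points are equal but not definitionally so, hence the comparison in the model space
`E'`. -/
theorem dproj_smul (hQ : IsQuotientManifold G E M E') (a : G) (x : M)
    (ha : MDifferentiableAt 𝓘(ℝ, E) 𝓘(ℝ, E) (fun y : M ↦ a • y) x)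
    (u : TangentSpace 𝓘(ℝ, E) x) :
    (dproj G E' (a • x) (mfderiv 𝓘(ℝ, E) 𝓘(ℝ, E) (fun y : M ↦ a • y) x u) : E') =
      dproj G E' x u := by
  have hcomp := mfderiv_comp x (g := (proj G : M → MulAction.orbitRel.Quotient G M))
    (I'' := 𝓘(ℝ, E')) ((hQ.contMDiff (a • x)).mdifferentiableAt (by simp)) ha
  have hproj : (proj G : M → MulAction.orbitRel.Quotient G M) ∘ (fun y : M ↦ a • y) = proj G :=
    funext (proj_smul a)
  have hcongr : ∀ f : M → MulAction.orbitRel.Quotient G M, f = proj G → ∀ v : E,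
      (mfderiv 𝓘(ℝ, E) 𝓘(ℝ, E') f x v : E') = dproj G E' x v := by
    rintro _ rfl v
    rfl
  exact (DFunLike.congr_fun hcomp u).symm.trans (hcongr _ hproj u)

variable [IsManifold 𝓘(ℝ, E) ∞ M]

namespace HorizontalSpace

variable (hQ : IsQuotientManifold G E M E') (H : HorizontalSpace G E M E')

theorem lift_mem (x : M) (ξ : TangentSpace 𝓘(ℝ, E') (proj G x)) : H.lift hQ x ξ ∈ H.space x :=
  Subtype.property _

theorem dproj_lift (x : M) (ξ : TangentSpace 𝓘(ℝ, E') (proj G x)) :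
    dproj G E' x (H.lift hQ x ξ) = ξ :=
  (LinearEquiv.ofBijective _ (H.bijective hQ x)).apply_symm_apply ξ

theorem lift_dproj (x : M) {u : TangentSpace 𝓘(ℝ, E) x} (hu : u ∈ H.space x) :
    H.lift hQ x (dproj G E' x u) = u :=
  congrArg Subtype.val
    ((LinearEquiv.ofBijective _ (H.bijective hQ x)).symm_apply_apply ⟨u, hu⟩)

/-- Horizontal lifts at `a • x` are the images under `dθ_a` of horizontal lifts at `x`. -/
theorem lift_smul (a : G) (x : M)
    (ha : MDifferentiableAt 𝓘(ℝ, E) 𝓘(ℝ, E) (fun y : M ↦ a • y) x) (ξ : E') :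
    H.lift hQ (a • x) ξ =
      mfderiv 𝓘(ℝ, E) 𝓘(ℝ, E) (fun y : M ↦ a • y) x (H.lift hQ x ξ) := by
  have hmem : mfderiv 𝓘(ℝ, E) 𝓘(ℝ, E) (fun y : M ↦ a • y) x (H.lift hQ x ξ) ∈
      H.space (a • x) := by
    rw [← H.invariant a x]
    exact Submodule.mem_map_of_mem (H.lift_mem hQ x ξ)
  have hd := (dproj_smul hQ a x ha (H.lift hQ x ξ)).trans (H.dproj_lift hQ x ξ)
  have hl := H.lift_dproj hQ (a • x) hmem
  exact (congrArg (H.lift hQ (a • x)) hd).symm.trans hl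

variable [FiniteDimensional ℝ E']

/-- The bilinear form `(ξ, η) ↦ g_x(lift_x ξ, lift_x η)` on the model space `E'`, which is the
tangent space of `M/G` at `[x]`. -/
noncomputable def pullbackForm (g : ContMDiffRiemannianMetric 𝓘(ℝ, E) ∞ E
    (fun x : M ↦ TangentSpace 𝓘(ℝ, E) x)) (x : M) : E' →L[ℝ] E' →L[ℝ] ℝ :=
  let L : E' →L[ℝ] E := LinearMap.toContinuousLinearMap (H.lift hQ x : E' →ₗ[ℝ] E)
  let b : E →L[ℝ] E →L[ℝ] ℝ := g.inner x
  b.bilinearComp L L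

theorem pullbackForm_apply (g : ContMDiffRiemannianMetric 𝓘(ℝ, E) ∞ E
    (fun x : M ↦ TangentSpace 𝓘(ℝ, E) x)) (x : M) (ξ η : E') :
    H.pullbackForm hQ g x ξ η = g.inner x (H.lift hQ x ξ) (H.lift hQ x η) :=
  rfl

/-- If the action is isometric, then the form induced at `[x]` does not depend on the representative
`x`. -/
theorem pullbackForm_eq_of_proj_eq
    (hsmul : ∀ a : G, MDifferentiable 𝓘(ℝ, E) 𝓘(ℝ, E) (fun y : M ↦ a • y))
    {g : ContMDiffRiemannianMetric 𝓘(ℝ, E) ∞ E (fun x : M ↦ TangentSpace 𝓘(ℝ, E) x)}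
    (hg : IsIsometricAction G g) {x y : M} (hxy : proj G x = proj G y) :
    H.pullbackForm hQ g x = H.pullbackForm hQ g y := by
  obtain ⟨a, rfl⟩ : x ∈ MulAction.orbit G y := Quotient.exact hxy
  ext ξ η
  change H.pullbackForm hQ g (a • y) ξ η = _
  rw [pullbackForm_apply, pullbackForm_apply, H.lift_smul hQ a y (hsmul a y),
    H.lift_smul hQ a y (hsmul a y)]
  exact hg a y _ _

variable [IsManifold 𝓘(ℝ, E') ∞ (MulAction.orbitRel.Quotient G M)]

/-- The metric on `M/G` that makes every horizontal lift isometric, computed at `[x]` from the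
representative chosen by `Quotient.out`. -/
noncomputable def quotientMetric
    (hsmul : ∀ a : G, MDifferentiable 𝓘(ℝ, E) 𝓘(ℝ, E) (fun y : M ↦ a • y))
    (g : ContMDiffRiemannianMetric 𝓘(ℝ, E) ∞ E (fun x : M ↦ TangentSpace 𝓘(ℝ, E) x))
    (hg : IsIsometricAction G g) :
    ContMDiffRiemannianMetric 𝓘(ℝ, E') ∞ E'
      (fun p : MulAction.orbitRel.Quotient G M ↦ TangentSpace 𝓘(ℝ, E') p) where
  inner p := pullbackForm (E' := E') hQ H g (Quotient.out p)
  symm _ _ _ := g.symm _ _ _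
  pos p ξ hξ := by
    refine g.pos _ _ fun h0 ↦ hξ ?_
    exact (H.dproj_lift hQ (Quotient.out p) ξ).symm.trans
      ((congrArg (dproj G E' (Quotient.out p)) h0).trans (map_zero _))
  isVonNBounded p := by
    -- The unit ball of the quotient metric is contained in the image under `dπ` of a unit ball.
    refine ((g.isVonNBounded (Quotient.out p)).image (dproj G E' (Quotient.out p))).subset ?_
    intro ξ hξ
    exact ⟨H.lift hQ (Quotient.out p) ξ, hξ, H.dproj_lift hQ _ ξ⟩
  contMDiff := by
    refine contMDiff_of_submersion_of_distribution hQ.contMDiff hQ.surjective proj_surjective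
      H.smooth (H.bijective hQ) g.contMDiff fun x u hu v hv ↦ ?_
    have hout : proj G (Quotient.out (proj G x)) = proj G x := Quotient.out_eq _
    exact (congrArg (fun b : E' →L[ℝ] E' →L[ℝ] ℝ ↦ b (dproj G E' x u) (dproj G E' x v))
      (H.pullbackForm_eq_of_proj_eq hQ hsmul hg hout)).trans
      (congrArg₂ (fun u v ↦ g.inner x u v) (H.lift_dproj hQ x hu) (H.lift_dproj hQ x hv))

theorem quotientMetric_inner_proj
    (hsmul : ∀ a : G, MDifferentiable 𝓘(ℝ, E) 𝓘(ℝ, E) (fun y : M ↦ a • y))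
    (g : ContMDiffRiemannianMetric 𝓘(ℝ, E) ∞ E (fun x : M ↦ TangentSpace 𝓘(ℝ, E) x))
    (hg : IsIsometricAction G g) (x : M) (ξ η : TangentSpace 𝓘(ℝ, E') (proj G x)) :
    (H.quotientMetric hQ hsmul g hg).inner (proj G x) ξ η =
      g.inner x (H.lift hQ x ξ) (H.lift hQ x η) := by
  have hout : proj G (Quotient.out (proj G x)) = proj G x := Quotient.out_eq _
  exact congrArg (fun b : E' →L[ℝ] E' →L[ℝ] ℝ ↦ b ξ η)
    (H.pullbackForm_eq_of_proj_eq hQ hsmul hg hout)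

end HorizontalSpace

end Lift

end QuotientMetric

theorem proposition3p3
    -- a finite-dimensional Lie group
    {F : Type*} [NormedAddCommGroup F] [NormedSpace ℝ F] [FiniteDimensional ℝ F]
    {G : Type*} [Group G] [TopologicalSpace G] [ChartedSpace F G] [T2Space G]
    [SecondCountableTopology G] [LieGroup 𝓘(ℝ, F) ∞ G]
    -- a finite-dimensional smooth manifold without boundary
    {E : Type*} [NormedAddCommGroup E] [NormedSpace ℝ E] [FiniteDimensional ℝ E]
    {M : Type*} [TopologicalSpace M] [ChartedSpace E M] [T2Space M]
    [SecondCountableTopology M] [IsManifold 𝓘(ℝ, E) ∞ M]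
    -- a smooth, proper and free action
    [MulAction G M] [ContMDiffSMul 𝓘(ℝ, F) 𝓘(ℝ, E) ∞ G M] [ProperSMul G M]
    (hfree : ∀ (a : G) (x : M), a • x = x → a = 1)
    -- the quotient manifold
    {E' : Type*} [NormedAddCommGroup E'] [NormedSpace ℝ E'] [FiniteDimensional ℝ E']
    [ChartedSpace E' (MulAction.orbitRel.Quotient G M)]
    [IsManifold 𝓘(ℝ, E') ∞ (MulAction.orbitRel.Quotient G M)]
    (hQ : QuotientMetric.IsQuotientManifold G E M E')
    -- a Riemannian metric for which the action is isometric, and a horizontal space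
    (g : Bundle.ContMDiffRiemannianMetric 𝓘(ℝ, E) ∞ E
      (fun x : M ↦ TangentSpace 𝓘(ℝ, E) x))
    (hg : QuotientMetric.IsIsometricAction G g)
    (H : QuotientMetric.HorizontalSpace G E M E') :
    ∃! ghat : Bundle.ContMDiffRiemannianMetric 𝓘(ℝ, E') ∞ E'
        (fun p : MulAction.orbitRel.Quotient G M ↦ TangentSpace 𝓘(ℝ, E') p),
      ∀ (x : M) (ξ η : TangentSpace 𝓘(ℝ, E') (QuotientMetric.proj G x)),
        ghat.inner (QuotientMetric.proj G x) ξ η =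
          g.inner x (H.lift hQ x ξ) (H.lift hQ x η) := by
  have hsmul : ∀ a : G, MDifferentiable 𝓘(ℝ, E) 𝓘(ℝ, E) (fun y : M ↦ a • y) := fun a ↦
    (ContMDiffSMul.contMDiff_const_smul (I := 𝓘(ℝ, F)) (n := ∞) a).mdifferentiable (by simp)
  refine ⟨H.quotientMetric hQ hsmul g hg, H.quotientMetric_inner_proj hQ hsmul g hg,
    fun ghat hghat ↦ ?_⟩
  -- Every point of `M/G` is of the form `[x]`, so the required identity determines the metric.
  have hinner : ghat.inner = (H.quotientMetric hQ hsmul g hg).inner := by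
    funext p
    obtain ⟨x, rfl⟩ := QuotientMetric.proj_surjective p
    ext ξ η
    exact (hghat x ξ η).trans (H.quotientMetric_inner_proj hQ hsmul g hg x ξ η).symm
  cases ghat
  cases hinner
  rfl
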